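/- \textbf{Setting.} Let $\mathcal I$ be a nonempty finite set of $n$ agents, $\mathcal A_i$ ($i\in\mathcal I$) nonempty finite action sets, $\mathcal A=\prod_i\mathcal A_i$, and $U_i:\mathcal A\to\mathbb R$ utilities admitting a potential $\phi:\mathcal A\to\mathbb R$, i.e. $U_i(a_i',a_{-i})-U_i(a_i,a_{-i})=\phi(a_i',a_{-i})-\phi(a_i,a_{-i})$ for all $i$, $a_i,a'_i$, $a_{-i}$. Let $\mathcal A_i^{\mathrm{cons}}(a_i)\subseteq\mathcal A_i$ be nonempty constrained action sets that satisfy reachability (for all $i$ and $x,y\in\mathcal A_i$ there is a finite sequence from $x$ to $y$ in which each action lies in the constrained action set of its predecessor) and reversibility ($y\in\mathcal A_i^{\mathrm{cons}}(x)$ implies $x\in\mathcal A_i^{\mathrm{cons}}(y)$). For $S\subseteq\mathcal I$ with $i\in S$ let $U_i(\cdot\,|S):\mathcal A\to\mathbb R$ be the utility that agent $i$ evaluates when it hears exactly the agents in $S$, where $U_i(\cdot\,|\mathcal I)=U_i$. For a temperature $\tau>0$ and a connectivity probability $p_c\in(0,1)$, binary log-linear learning with stochastic links is the following Markov chain on $\mathcal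 A$. At the current profile $a$, an agent $i$ is chosen uniformly at random, a trial action $\hat a_i$ is drawn uniformly from $\mathcal A_i^{\mathrm{cons}}(a_i)$, and independently a random set $S\ni i$ is drawn that contains each $j\neq i$ independently with probability $p_c$. With $\hat a=(\hat a_i,a_{-i})$, the chain moves to $\hat a$ with probability $e^{U_i(\hat a|S)/\tau}/(e^{U_i(a|S)/\tau}+e^{U_i(\hat a|S)/\tau})$ and otherwise stays at $a$. \textbf{Theorem.} Let $m>0$ be a constant such that $$(n-|S|)\,m\;\ge\;\big(\max\{U_i(a),U_i(b)\}-U_i(b)\big)-\big(\max\{U_i(a|S),U_i(b|S)\}-U_i(b|S)\big)$$ for every $i\in\mathcal I$, every $S\subseteq\mathcal I$ with $i\in S$, every $a\in\mathcal A$ and every $b=(b_i,a_{-i})$ with $b_i\in\mathcal A_i^{\mathrm{cons}}(a_i)$. Then for every $p_{\mathrm{tar}}<1$ there is $p_{c,\mathrm{th}}\in(\tfrac12,1)$ such that, for every $p_c$ with $p_{c,\mathrm{th}}\le p_c<1$ and $\tau=-m/\ln\!\big(\tfrac{1-p_c}{p_c}\big)$, the chain has a unique stationary distribution $\mu$, and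 $$\sum_{a\in\mathcal A^*}\mu_a\ \ge\ p_{\mathrm{tar}},\qquad \mathcal A^*=\{a\in\mathcal A:\phi(a)=\max_{\mathcal A}\phi\}.$$ -/

import Mathlib

open Finset

noncomputable section

namespace BLLL

universe u v

variable {ι : Type u} {A : ι → Type v}

/-- `φ` is a potential function for the game with utilities `U i`: for every agent and every
profile of the other agents, a unilateral change of action changes the utility of the deviating
agent and the potential by the same amount. -/
def IsPotential [DecidableEq ι] (U : ι → (∀ i, A i) → ℝ) (φ : (∀ i, A i) → ℝ) : Prop :=
  ∀ (i : ι) (a : ∀ i, A i) (x x' : A i),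
    U i (Function.update a i x') - U i (Function.update a i x) =
      φ (Function.update a i x') - φ (Function.update a i x)

/-- Reachability: any action of any agent can be reached from any other action of that agent by a
finite sequence of actions, each in the constrained action set of the preceding one. -/
def Reachable (C : ∀ i, A i → Finset (A i)) : Prop :=
  ∀ (i : ι) (x y : A i), Relation.ReflTransGen (fun u v => v ∈ C i u) x y

/-- Reversibility: if `y` is admissible from `x`, then `x` is admissible from `y`. -/
def Reversible (C : ∀ i, A i → Finset (A i)) : Prop :=
  ∀ (i : ι) (x y : A i), y ∈ C i x → x ∈ C i y

/-- `W i S` is the utility evaluated by agent `i` when it communicates with exactly the agents in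
`S`. It extends the utility `U i`, which is the value under full communication. -/
def ExtendsUtility [Fintype ι] (W : ι → Finset ι → (∀ i, A i) → ℝ)
    (U : ι → (∀ i, A i) → ℝ) : Prop :=
  ∀ (i : ι) (a : ∀ i, A i), W i Finset.univ a = U i a

/-- Resistance, for the utility function `w` of the moving agent, of the transition `a → b`:
`max (w a) (w b) - w b`. -/
def resistance (w : (∀ i, A i) → ℝ) (a b : ∀ i, A i) : ℝ :=
  max (w a) (w b) - w b

/-- The resistance bound on the link constants `m i j a`: for every agent `i`, every set `S` of
agents that `i` may be able to hear (an agent always hears itself) and every feasible transition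
`a → b`, where `b` is `a` with the action of `i` changed to an admissible one,
the resistance `R(a → b)` under perfect communication minus the resistance `R_c(a → b | S)`
is at most the sum of the `m i j a` over the agents `j` outside `S`. -/
def LinkBound [Fintype ι] [DecidableEq ι] (U : ι → (∀ i, A i) → ℝ)
    (W : ι → Finset ι → (∀ i, A i) → ℝ) (C : ∀ i, A i → Finset (A i))
    (m : ι → ι → (∀ i, A i) → ℝ) : Prop :=
  ∀ (i : ι) (S : Finset ι), i ∈ S → ∀ (a : ∀ i, A i), ∀ x ∈ C i (a i),
    resistance (U i) a (Function.update a i x) -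
        resistance (W i S) a (Function.update a i x) ≤
      ∑ j ∈ Sᶜ, m i j a

/-- State-independent probability of connectivity, equal to `pc` for all links; an agent always
hears itself. -/
def uniformLink [DecidableEq ι] (A : ι → Type v) (pc : ℝ) : ι → ι → (∀ i, A i) → ℝ :=
  fun i j _ => if i = j then 1 else pc

/-- Probability that the set of agents heard by agent `i` is exactly `S`, when the links are
independent and the link between `i` and `j` is present with probability `p i j a`. -/
def realizationProb [Fintype ι] [DecidableEq ι] (p : ι → ι → (∀ i, A i) → ℝ)
    (i : ι) (S : Finset ι) (a : ∀ i, A i) : ℝ :=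
  (∏ j ∈ Sᶜ, (1 - p i j a)) * ∏ j ∈ S, p i j a

/-- Binary log-linear choice at temperature `τ` for an agent with utility `w`, at current profile
`a` and trial profile `b`: the probability of adopting the trial profile. -/
def acceptProb (w : (∀ i, A i) → ℝ) (τ : ℝ) (a b : ∀ i, A i) : ℝ :=
  Real.exp (1 / τ * w b) / (Real.exp (1 / τ * w a) + Real.exp (1 / τ * w b))

/-- The probability of keeping the current profile in the same choice. -/
def keepProb (w : (∀ i, A i) → ℝ) (τ : ℝ) (a b : ∀ i, A i) : ℝ :=
  Real.exp (1 / τ * w a) / (Real.exp (1 / τ * w a) + Real.exp (1 / τ * w b))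

/-- One-step transition matrix of binary log-linear learning with stochastic communication links:
an agent `i` is chosen uniformly, a trial action `x` is chosen uniformly from the constrained
action set of its current action, the set `S` of agents heard by `i` is drawn, and `i` adopts `x`
or keeps its current action by the binary log-linear choice with the utility evaluated from `S`. -/
def transition [Fintype ι] [DecidableEq ι] [∀ i, DecidableEq (A i)]
    (W : ι → Finset ι → (∀ i, A i) → ℝ) (C : ∀ i, A i → Finset (A i))
    (p : ι → ι → (∀ i, A i) → ℝ) (τ : ℝ) : Matrix (∀ i, A i) (∀ i, A i) ℝ :=
  fun a b =>
    ∑ i : ι, 1 / (Fintype.card ι : ℝ) *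
      ∑ x ∈ C i (a i), 1 / (((C i (a i)).card : ℕ) : ℝ) *
        ∑ S : Finset ι, realizationProb p i S a *
          ((if b = Function.update a i x then
              acceptProb (W i S) τ a (Function.update a i x) else 0) +
            (if b = a then keepProb (W i S) τ a (Function.update a i x) else 0))

/-- `μ` is a stationary distribution of the Markov chain with transition matrix `P`. -/
def IsStationary {X : Type*} [Fintype X] (P : Matrix X X ℝ) (μ : X → ℝ) : Prop :=
  μ ∈ stdSimplex ℝ X ∧ Matrix.vecMul μ P = μ

/-- The set of potential maximizers. -/
def maximizers [Fintype ι] [DecidableEq ι] [∀ i, Fintype (A i)] (φ : (∀ i, A i) → ℝ) :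
    Finset (∀ i, A i) :=
  {a | ∀ b, φ b ≤ φ a}

end BLLL

end

/-!
The chain is almost reversible. Write `β = 1 / τ`; the choice of `τ` makes
`exp (-β m) = (1 - pc) / pc`, so losing the links to `k` agents costs a factor of at most
`exp (-β m k)`. By the bound on the resistances this is enough to compensate for the smaller
resistance of a transition evaluated with missing links, and therefore every feasible transition
`a → b` has probability `exp (-β (max (φ a) (φ b) - φ b))` up to constant factors that do not
depend on `β` (`transition_le`, `le_transition`). With the Gibbs weights `w a = exp (β φ a)`, the
products `w a * P a b` and `w b * P b a` are both `exp (β min (φ a) (φ b))` up to such factors, so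
detailed balance holds up to a constant `D` (`gibbs_almost_reversible`).

For an irreducible chain with `N` states this forces every invariant vector to be proportional to
`w` up to the factor `D ^ N` (`almost_proportional`): the flow across any cut is balanced, so the
ratio `μ / w` cannot drop by more than a factor `D` across a cut, and at most `N` successive cuts
separate any two states. This takes the place of the Markov chain tree theorem. Finally, the Gibbs
weight of a state that does not maximize `φ`, relative to that of a maximizer, vanishes as `β → ∞`,
that is, as `pc → 1`.
-/

namespace BLLL

/-! ### Invariant vectors of finite Markov chains -/

section MarkovChain

/-- In an irreducible chain every nonempty proper set of states can be left in one step. -/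
lemma exists_edge_out {X : Type*} {P : Matrix X X ℝ}
    (hirr : ∀ a b, Relation.ReflTransGen (fun x y => 0 < P x y) a b)
    (S : Finset X) {a b : X} (ha : a ∈ S) (hb : b ∉ S) :
    ∃ x ∈ S, ∃ y ∉ S, 0 < P x y := by
  by_contra! h
  refine hb (Relation.ReflTransGen.head_induction_on (motive := fun x _ => x ∈ S → b ∈ S)
    (hirr a b) id (fun {x y} hxy _ ih hx => ih ?_) ha)
  by_contra hy
  exact absurd (h x hx y hy) (not_le.2 hxy)

variable {X : Type*} [Fintype X] {P : Matrix X X ℝ}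

/-- The flow of an invariant vector out of a set of states equals the flow into it. -/
lemma flow_balance [DecidableEq X] (hP1 : ∀ a, ∑ b, P a b = 1) {v : X → ℝ}
    (hv : Matrix.vecMul v P = v) (B : Finset X) :
    ∑ a ∈ B, ∑ b ∈ Bᶜ, v a * P a b = ∑ a ∈ B, ∑ b ∈ Bᶜ, v b * P b a := by
  have h1 : ∑ a ∈ B, v a = ∑ a ∈ B, ∑ b ∈ B, v a * P a b + ∑ a ∈ B, ∑ b ∈ Bᶜ, v a * P a b := by
    rw [← Finset.sum_add_distrib]
    refine Finset.sum_congr rfl fun a _ => ?_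
    rw [Finset.sum_add_sum_compl, ← Finset.mul_sum, hP1, mul_one]
  have h2 : ∑ a ∈ B, v a = ∑ a ∈ B, ∑ b ∈ B, v b * P b a + ∑ a ∈ B, ∑ b ∈ Bᶜ, v b * P b a := by
    rw [← Finset.sum_add_distrib]
    refine Finset.sum_congr rfl fun a _ => ?_
    rw [Finset.sum_add_sum_compl]
    exact (congrFun hv a).symm
  rw [Finset.sum_comm (s := B) (t := B)] at h1
  linarith

/-- If detailed balance with respect to `w` holds up to the factor `D`, the ratio `v / w` of an
invariant vector drops by at most the factor `D` somewhere on the boundary of any set of states: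
otherwise the flow out of the complement of `S` would exceed the flow into it. -/
lemma exists_ratio_le (hP0 : ∀ a b, 0 ≤ P a b) (hP1 : ∀ a, ∑ b, P a b = 1)
    (hirr : ∀ a b, Relation.ReflTransGen (fun x y => 0 < P x y) a b)
    {w : X → ℝ} (hw : ∀ a, 0 < w a) {D : ℝ} (hD : 0 < D)
    (hrev : ∀ a b, w b * P b a ≤ D * (w a * P a b))
    {v : X → ℝ} (hv0 : ∀ a, 0 ≤ v a) (hv : Matrix.vecMul v P = v)
    (S : Finset X) {s t : X} (hs : s ∈ S) (ht : t ∉ S) :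
    ∃ x ∈ S, ∃ y ∉ S, v y / w y ≤ D * (v x / w x) := by
  classical
  by_contra! h
  have key : ∀ y ∈ Sᶜ, ∀ x ∈ S, v x * P x y ≤ v y * P y x ∧
      (0 < P x y → v x * P x y < v y * P y x) := by
    intro y hy x hx
    have h1 := h x hx y (Finset.mem_compl.1 hy)
    have h2 := hrev y x
    have hvy : 0 ≤ v y / w y := div_nonneg (hv0 y) (hw y).le
    have e1 : v x * P x y = v x / w x * (w x * P x y) := by
      have := (hw x).ne'
      field_simp
    have e2 : v y * P y x = v y / w y * (w y * P y x) := by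
      have := (hw y).ne'
      field_simp
    have h3 : v y / w y * (w x * P x y) ≤ D * (v y * P y x) := by
      rw [e2]
      calc _ ≤ v y / w y * (D * (w y * P y x)) := mul_le_mul_of_nonneg_left h2 hvy
        _ = _ := by ring
    have h4 : D * (v x * P x y) = D * (v x / w x) * (w x * P x y) := by rw [e1]; ring
    refine ⟨le_of_mul_le_mul_left ?_ hD, fun hpos => lt_of_mul_lt_mul_left ?_ hD.le⟩
    · rw [h4]
      exact (mul_le_mul_of_nonneg_right h1.le (mul_nonneg (hw x).le (hP0 x y))).trans h3
    · rw [h4]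
      exact (mul_lt_mul_of_pos_right h1 (mul_pos (hw x) hpos)).trans_le h3
  obtain ⟨x, hx, y, hy, hxy⟩ := exists_edge_out hirr S hs ht
  have hb := flow_balance hP1 hv Sᶜ
  rw [compl_compl] at hb
  refine hb.not_gt (Finset.sum_lt_sum
    (fun y hy => Finset.sum_le_sum fun x hx => (key y hy x hx).1)
    ⟨y, Finset.mem_compl.2 hy, Finset.sum_lt_sum (fun x hx => (key y (Finset.mem_compl.2 hy) x hx).1)
      ⟨x, hx, (key y (Finset.mem_compl.2 hy) x hx).2 hxy⟩⟩)

/-- If an irreducible chain satisfies detailed balance with respect to `w` up to the factor `D`,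
then its nonnegative invariant vectors are proportional to `w` up to the factor `D ^ N`, where `N`
is the number of states. -/
lemma almost_proportional (hP0 : ∀ a b, 0 ≤ P a b) (hP1 : ∀ a, ∑ b, P a b = 1)
    (hirr : ∀ a b, Relation.ReflTransGen (fun x y => 0 < P x y) a b)
    {w : X → ℝ} (hw : ∀ a, 0 < w a) {D : ℝ} (hD : 1 ≤ D)
    (hrev : ∀ a b, w b * P b a ≤ D * (w a * P a b))
    {v : X → ℝ} (hv0 : ∀ a, 0 ≤ v a) (hv : Matrix.vecMul v P = v) (a b : X) :
    v a / w a ≤ D ^ Fintype.card X * (v b / w b) := by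
  classical
  have hD0 : 0 < D := one_pos.trans_le hD
  -- The sublevel sets `{x | v x / w x ≤ D ^ k * (v b / w b)}` grow strictly until they exhaust `X`.
  let T : ℕ → Finset X := fun k => {x | v x / w x ≤ D ^ k * (v b / w b)}
  have hT : ∀ k x, x ∈ T k ↔ v x / w x ≤ D ^ k * (v b / w b) := fun k x => by simp [T]
  have hvb : 0 ≤ v b / w b := div_nonneg (hv0 b) (hw b).le
  have hbT : ∀ k, b ∈ T k := fun k => (hT k b).2 (le_mul_of_one_le_left hvb (one_le_pow₀ hD))
  have hmono : ∀ k, T k ⊆ T (k + 1) := fun k x hx => (hT _ x).2 (((hT k x).1 hx).trans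
    (mul_le_mul_of_nonneg_right (pow_le_pow_right₀ hD k.le_succ) hvb))
  have hgrow : ∀ k, T k = Finset.univ ∨ k + 1 ≤ (T k).card := by
    intro k
    induction k with
    | zero => exact Or.inr (Finset.card_pos.2 ⟨b, hbT 0⟩)
    | succ k ih =>
      by_cases hk : T k = Finset.univ
      · exact Or.inl (Finset.univ_subset_iff.1 (hk ▸ hmono k))
      · right
        obtain ⟨t, ht⟩ : ∃ t, t ∉ T k := by
          by_contra! h
          exact hk (Finset.eq_univ_iff_forall.2 h)
        obtain ⟨x, hx, y, hy, hxy⟩ :=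
          exists_ratio_le hP0 hP1 hirr hw hD0 hrev hv0 hv (T k) (hbT k) ht
        have hy' : y ∈ T (k + 1) := by
          rw [hT, pow_succ']
          refine hxy.trans ?_
          rw [mul_assoc]
          exact mul_le_mul_of_nonneg_left ((hT k x).1 hx) hD0.le
        have := Finset.card_lt_card
          (Finset.ssubset_iff_subset_ne.2 ⟨hmono k, fun h => hy (h ▸ hy')⟩)
        have := ih.resolve_left hk
        omega
  rcases hgrow (Fintype.card X) with h | h
  · exact (hT _ a).1 (h ▸ Finset.mem_univ a)
  · exact absurd (h.trans (Finset.card_le_univ _)) (by omega)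

/-- The absolute value of an invariant vector is invariant: `|v| ≤ |v| P` holds entrywise, and both
sides have the same total mass. -/
lemma vecMul_abs (hP0 : ∀ a b, 0 ≤ P a b) (hP1 : ∀ a, ∑ b, P a b = 1) {v : X → ℝ}
    (hv : Matrix.vecMul v P = v) : Matrix.vecMul (fun a => |v a|) P = fun a => |v a| := by
  have hle : ∀ b ∈ Finset.univ, |v b| ≤ Matrix.vecMul (fun a => |v a|) P b := by
    intro b _
    calc |v b| = |∑ a, v a * P a b| := congrArg _ (congrFun hv b).symm
      _ ≤ ∑ a, |v a * P a b| := Finset.abs_sum_le_sum_abs _ _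
      _ = ∑ a, |v a| * P a b :=
        Finset.sum_congr rfl fun a _ => by rw [abs_mul, abs_of_nonneg (hP0 a b)]
  have hsum : ∑ b, |v b| = ∑ b, Matrix.vecMul (fun a => |v a|) P b := by
    change _ = ∑ b, ∑ a, |v a| * P a b
    rw [Finset.sum_comm]
    exact Finset.sum_congr rfl fun a _ => by rw [← Finset.mul_sum, hP1, mul_one]
  funext b
  exact ((Finset.sum_eq_sum_iff_of_le hle).1 hsum b (Finset.mem_univ b)).symm

lemma exists_isStationary [Nonempty X] (hP0 : ∀ a b, 0 ≤ P a b) (hP1 : ∀ a, ∑ b, P a b = 1) :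
    ∃ μ, IsStationary P μ := by
  classical
  -- The constant vectors are fixed by `P`, so `1 - P` is singular and also has a left null vector.
  have hdet : (1 - P).det = 0 := by
    refine Matrix.exists_mulVec_eq_zero_iff.1 ⟨fun _ => 1, fun h => ?_, ?_⟩
    · exact one_ne_zero (congrFun h (Classical.arbitrary X))
    · rw [Matrix.sub_mulVec, Matrix.one_mulVec]
      funext a
      simp [Matrix.mulVec, dotProduct, hP1]
  obtain ⟨v, hv0, hv⟩ := Matrix.exists_vecMul_eq_zero_iff.2 hdet
  rw [Matrix.vecMul_sub, Matrix.vecMul_one, sub_eq_zero] at hv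
  have habs := vecMul_abs hP0 hP1 hv.symm
  have hpos : 0 < ∑ a, |v a| := by
    obtain ⟨a, ha⟩ := Function.ne_iff.1 hv0
    exact Finset.sum_pos' (fun _ _ => abs_nonneg _) ⟨a, Finset.mem_univ a, abs_pos.2 ha⟩
  refine ⟨(∑ a, |v a|)⁻¹ • fun a => |v a|, ⟨fun a => ?_, ?_⟩, ?_⟩
  · exact mul_nonneg (inv_nonneg.2 hpos.le) (abs_nonneg _)
  · simp only [Pi.smul_apply, smul_eq_mul, ← Finset.mul_sum]
    exact inv_mul_cancel₀ hpos.ne'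
  · rw [Matrix.smul_vecMul, habs]

/-- A nonnegative invariant vector of an irreducible chain that is positive somewhere is positive
everywhere. -/
lemma invariant_pos (hP0 : ∀ a b, 0 ≤ P a b)
    (hirr : ∀ a b, Relation.ReflTransGen (fun x y => 0 < P x y) a b)
    {v : X → ℝ} (hv0 : ∀ a, 0 ≤ v a) (hv : Matrix.vecMul v P = v) {a : X} (ha : 0 < v a) (b : X) :
    0 < v b := by
  induction hirr a b with
  | refl => exact ha
  | @tail x y _ hxy ih =>
    have h : ∑ z, v z * P z y = v y := congrFun hv y
    rw [← h]
    exact Finset.sum_pos' (fun z _ => mul_nonneg (hv0 z) (hP0 z y))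
      ⟨x, Finset.mem_univ x, mul_pos ih hxy⟩

/-- Uniqueness of the stationary distribution of an irreducible chain: the positive part of the
difference of two stationary distributions, if nonzero, is positive everywhere, although the
difference sums to zero. -/
lemma isStationary_unique (hP0 : ∀ a b, 0 ≤ P a b) (hP1 : ∀ a, ∑ b, P a b = 1)
    (hirr : ∀ a b, Relation.ReflTransGen (fun x y => 0 < P x y) a b)
    {μ ν : X → ℝ} (hμ : IsStationary P μ) (hν : IsStationary P ν) : μ = ν := by
  have hd : Matrix.vecMul (μ - ν) P = μ - ν := by rw [Matrix.sub_vecMul, hμ.2, hν.2]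
  have habs := vecMul_abs hP0 hP1 hd
  have hsum : ∑ a, (μ - ν) a = 0 := by
    simp only [Pi.sub_apply, Finset.sum_sub_distrib, hμ.1.2, hν.1.2, sub_self]
  have hle : ∀ a ∈ Finset.univ, (μ - ν) a ≤ 0 := by
    by_contra! h
    obtain ⟨a, _, ha⟩ := h
    have hinv : Matrix.vecMul ((fun x => |(μ - ν) x|) + (μ - ν)) P =
        (fun x => |(μ - ν) x|) + (μ - ν) := by rw [Matrix.add_vecMul, habs, hd]
    have hall : ∀ b, 0 < |(μ - ν) b| + (μ - ν) b := invariant_pos hP0 hirr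
      (fun x => by
        have := neg_abs_le ((μ - ν) x)
        change 0 ≤ |(μ - ν) x| + (μ - ν) x
        linarith) hinv (a := a) (by
          have := abs_nonneg ((μ - ν) a)
          change 0 < |(μ - ν) a| + (μ - ν) a
          linarith)
    refine hsum.not_gt (Finset.sum_pos (fun b _ => ?_) ⟨a, Finset.mem_univ a⟩)
    by_contra! hb
    have := hall b
    rw [abs_of_nonpos hb] at this
    linarith
  funext a
  exact sub_eq_zero.1 ((Finset.sum_eq_zero_iff_of_nonpos hle).1 hsum a (Finset.mem_univ a))

end MarkovChain

/-! ### Binary log-linear choice -/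

section Choice

universe u v

variable {ι : Type u} {A : ι → Type v}

lemma acceptProb_nonneg (w : (∀ i, A i) → ℝ) (τ : ℝ) (a b : ∀ i, A i) :
    0 ≤ acceptProb w τ a b := by
  unfold acceptProb; positivity

lemma keepProb_nonneg (w : (∀ i, A i) → ℝ) (τ : ℝ) (a b : ∀ i, A i) : 0 ≤ keepProb w τ a b := by
  unfold keepProb; positivity

lemma acceptProb_add_keepProb (w : (∀ i, A i) → ℝ) (τ : ℝ) (a b : ∀ i, A i) :
    acceptProb w τ a b + keepProb w τ a b = 1 := by
  unfold acceptProb keepProb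
  rw [← add_div, add_comm, div_self (by positivity)]

lemma exp_neg_resistance (w : (∀ i, A i) → ℝ) {τ : ℝ} (hτ : 0 < τ) (a b : ∀ i, A i) :
    Real.exp (-(1 / τ * resistance w a b)) =
      Real.exp (1 / τ * w b) / max (Real.exp (1 / τ * w a)) (Real.exp (1 / τ * w b)) := by
  rw [← Real.exp_monotone.map_max, ← mul_max_of_nonneg _ _ (by positivity), ← Real.exp_sub,
    resistance]
  congr 1
  ring

lemma acceptProb_le (w : (∀ i, A i) → ℝ) {τ : ℝ} (hτ : 0 < τ) (a b : ∀ i, A i) :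
    acceptProb w τ a b ≤ Real.exp (-(1 / τ * resistance w a b)) := by
  rw [exp_neg_resistance w hτ, acceptProb]
  have ha := Real.exp_pos (1 / τ * w a)
  have hb := Real.exp_pos (1 / τ * w b)
  exact div_le_div_of_nonneg_left hb.le (lt_max_of_lt_left ha)
    (max_le (by linarith) (by linarith))

lemma le_acceptProb (w : (∀ i, A i) → ℝ) {τ : ℝ} (hτ : 0 < τ) (a b : ∀ i, A i) :
    1 / 2 * Real.exp (-(1 / τ * resistance w a b)) ≤ acceptProb w τ a b := by
  rw [exp_neg_resistance w hτ, acceptProb, one_div, inv_mul_eq_div, div_div]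
  have ha := Real.exp_pos (1 / τ * w a)
  have hb := Real.exp_pos (1 / τ * w b)
  refine div_le_div_of_nonneg_left hb.le (by linarith) ?_
  linarith [le_max_left (Real.exp (1 / τ * w a)) (Real.exp (1 / τ * w b)),
    le_max_right (Real.exp (1 / τ * w a)) (Real.exp (1 / τ * w b))]

/-- Along a unilateral deviation the utility of the deviating agent and the potential have the same
resistance. -/
lemma IsPotential.resistance_eq [DecidableEq ι] {U : ι → (∀ i, A i) → ℝ} {φ : (∀ i, A i) → ℝ}
    (hφ : IsPotential U φ) (i : ι) (a : ∀ i, A i) (x : A i) :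
    resistance (U i) a (Function.update a i x) = resistance φ a (Function.update a i x) := by
  have h := hφ i a (a i) x
  rw [Function.update_eq_self] at h
  rw [resistance, resistance, ← max_sub_sub_right, ← max_sub_sub_right, sub_self, sub_self]
  congr 1
  linarith

end Choice

/-! ### Stochastic links -/

section Links

universe u v

variable {ι : Type u} [DecidableEq ι] {A : ι → Type v} {pc : ℝ}

lemma uniformLink_nonneg (h0 : 0 ≤ pc) (i j : ι) (a : ∀ i, A i) : 0 ≤ uniformLink A pc i j a := by
  unfold uniformLink; split_ifs <;> simp [h0]

lemma uniformLink_le_one (h1 : pc ≤ 1) (i j : ι) (a : ∀ i, A i) : uniformLink A pc i j a ≤ 1 := by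
  unfold uniformLink; split_ifs <;> simp [h1]

variable [Fintype ι]

lemma realizationProb_nonneg (h0 : 0 ≤ pc) (h1 : pc ≤ 1) (i : ι) (S : Finset ι) (a : ∀ i, A i) :
    0 ≤ realizationProb (uniformLink A pc) i S a :=
  mul_nonneg (Finset.prod_nonneg fun j _ => sub_nonneg.2 (uniformLink_le_one h1 i j a))
    (Finset.prod_nonneg fun j _ => uniformLink_nonneg h0 i j a)

lemma sum_realizationProb (p : ι → ι → (∀ i, A i) → ℝ) (i : ι) (a : ∀ i, A i) :
    ∑ S : Finset ι, realizationProb p i S a = 1 := by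
  have h := Finset.prod_add (fun j => p i j a) (fun j => 1 - p i j a) Finset.univ
  simp only [add_sub_cancel, Finset.prod_const_one, Finset.powerset_univ] at h
  rw [h]
  refine Finset.sum_congr rfl fun S _ => ?_
  rw [realizationProb, mul_comm, Finset.compl_eq_univ_sdiff]

/-- An agent always hears itself. -/
lemma realizationProb_eq_zero {i : ι} {S : Finset ι} (hi : i ∉ S) (a : ∀ i, A i) :
    realizationProb (uniformLink A pc) i S a = 0 := by
  rw [realizationProb, Finset.prod_eq_zero (Finset.mem_compl.2 hi), zero_mul]
  simp [uniformLink]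

/-- If `q` bounds the probability of a missing link, then the links to all agents outside `S` are
missing with probability at most `q ^ |Sᶜ|`. -/
lemma realizationProb_le (h0 : 0 ≤ pc) (h1 : pc ≤ 1) {q : ℝ} (hq : 1 - pc ≤ q) {i : ι}
    {S : Finset ι} (hi : i ∈ S) (a : ∀ i, A i) :
    realizationProb (uniformLink A pc) i S a ≤ q ^ Sᶜ.card := by
  have hp : ∏ j ∈ Sᶜ, (1 - uniformLink A pc i j a) ≤ q ^ Sᶜ.card := by
    rw [← Finset.prod_const]
    refine Finset.prod_le_prod (fun j _ => sub_nonneg.2 (uniformLink_le_one h1 i j a))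
      fun j hj => ?_
    have hij : i ≠ j := fun h => Finset.mem_compl.1 hj (h ▸ hi)
    simpa [uniformLink, hij] using hq
  have hs : ∏ j ∈ S, uniformLink A pc i j a ≤ 1 :=
    Finset.prod_le_one (fun j _ => uniformLink_nonneg h0 i j a)
      fun j _ => uniformLink_le_one h1 i j a
  exact (mul_le_of_le_one_right
    (Finset.prod_nonneg fun j _ => sub_nonneg.2 (uniformLink_le_one h1 i j a)) hs).trans hp

lemma le_realizationProb_univ (h : 1 / 2 ≤ pc) (i : ι) (a : ∀ i, A i) :
    (1 / 2 : ℝ) ^ Fintype.card ι ≤ realizationProb (uniformLink A pc) i Finset.univ a := by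
  rw [realizationProb, Finset.compl_univ, Finset.prod_empty, one_mul, ← Finset.card_univ,
    ← Finset.prod_const]
  refine Finset.prod_le_prod (fun _ _ => by norm_num) fun j _ => ?_
  unfold uniformLink
  split_ifs
  · norm_num
  · exact h

end Links

/-! ### Bounds on the transition matrix -/

section Transition

universe u v

variable {ι : Type u} [Fintype ι] [DecidableEq ι] {A : ι → Type v} [∀ i, DecidableEq (A i)]
  {U : ι → (∀ i, A i) → ℝ} {φ : (∀ i, A i) → ℝ} {C : ∀ i, A i → Finset (A i)}
  {W : ι → Finset ι → (∀ i, A i) → ℝ} {m pc τ : ℝ}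

lemma transition_nonneg (h0 : 0 ≤ pc) (h1 : pc ≤ 1) (a b : ∀ i, A i) :
    0 ≤ transition W C (uniformLink A pc) τ a b := by
  refine Finset.sum_nonneg fun i _ => mul_nonneg (by positivity) <| Finset.sum_nonneg fun x _ =>
    mul_nonneg (by positivity) <| Finset.sum_nonneg fun S _ =>
      mul_nonneg (realizationProb_nonneg h0 h1 i S a) (add_nonneg ?_ ?_)
  · split_ifs
    exacts [acceptProb_nonneg _ _ _ _, le_rfl]
  · split_ifs
    exacts [keepProb_nonneg _ _ _ _, le_rfl]

lemma sum_transition [Nonempty ι] [∀ i, Fintype (A i)] (hC : ∀ i x, (C i x).Nonempty)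
    (p : ι → ι → (∀ i, A i) → ℝ) (a : ∀ i, A i) : ∑ b, transition W C p τ a b = 1 := by
  unfold transition
  rw [Finset.sum_comm]
  have hi : ∀ i, ∑ b, 1 / (Fintype.card ι : ℝ) * ∑ x ∈ C i (a i),
      1 / (((C i (a i)).card : ℕ) : ℝ) * ∑ S : Finset ι, realizationProb p i S a *
        ((if b = Function.update a i x then acceptProb (W i S) τ a (Function.update a i x) else 0) +
          (if b = a then keepProb (W i S) τ a (Function.update a i x) else 0)) =
      1 / (Fintype.card ι : ℝ) := by
    intro i
    rw [← Finset.mul_sum, Finset.sum_comm]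
    have hx : ∀ x ∈ C i (a i), ∑ b, 1 / (((C i (a i)).card : ℕ) : ℝ) *
        ∑ S : Finset ι, realizationProb p i S a *
        ((if b = Function.update a i x then acceptProb (W i S) τ a (Function.update a i x) else 0) +
          (if b = a then keepProb (W i S) τ a (Function.update a i x) else 0)) =
        1 / (((C i (a i)).card : ℕ) : ℝ) := by
      intro x _
      rw [← Finset.mul_sum, Finset.sum_comm]
      simp only [← Finset.mul_sum, Finset.sum_add_distrib, Finset.sum_ite_eq', Finset.mem_univ,
        if_true, acceptProb_add_keepProb, mul_one, sum_realizationProb]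
    have hc : (((C i (a i)).card : ℕ) : ℝ) ≠ 0 := Nat.cast_ne_zero.2 (hC i (a i)).card_pos.ne'
    rw [Finset.sum_congr rfl hx, Finset.sum_const, nsmul_eq_mul, mul_one_div_cancel hc, mul_one]
  rw [Finset.sum_congr rfl fun i _ => hi i, Finset.sum_const, nsmul_eq_mul, Finset.card_univ,
    mul_one_div_cancel (Nat.cast_ne_zero.2 Fintype.card_ne_zero)]

lemma transition_eq_zero (p : ι → ι → (∀ i, A i) → ℝ) {a b : ∀ i, A i} (hab : b ≠ a)
    (h : ∀ i, ∀ x ∈ C i (a i), b ≠ Function.update a i x) : transition W C p τ a b = 0 := by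
  refine Finset.sum_eq_zero fun i _ => ?_
  rw [Finset.sum_eq_zero, mul_zero]
  intro x hx
  simp [hab, h i x hx]

/-- Upper bound on the transition probabilities by the resistance of the potential. When the agents
outside `S` are not heard, the probability of this event makes up for the decrease in resistance. -/
lemma transition_le [Nonempty ι] (hφ : IsPotential U φ) (hC : ∀ i x, (C i x).Nonempty)
    (hbound : LinkBound U W C (fun _ _ _ => m)) (h0 : 0 ≤ pc) (h1 : pc ≤ 1) (hτ : 0 < τ)
    (hq : 1 - pc ≤ Real.exp (-(1 / τ * m))) {a b : ∀ i, A i} (hab : b ≠ a) :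
    transition W C (uniformLink A pc) τ a b ≤
      2 ^ Fintype.card ι * Real.exp (-(1 / τ * resistance φ a b)) := by
  set K : ℝ := 2 ^ Fintype.card ι * Real.exp (-(1 / τ * resistance φ a b)) with hK
  have hS : ∀ i, ∀ x ∈ C i (a i), ∀ S : Finset ι, realizationProb (uniformLink A pc) i S a *
      ((if b = Function.update a i x then acceptProb (W i S) τ a (Function.update a i x) else 0) +
        (if b = a then keepProb (W i S) τ a (Function.update a i x) else 0)) ≤
      Real.exp (-(1 / τ * resistance φ a b)) := by
    intro i x hx S
    rw [if_neg hab, add_zero]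
    by_cases hi : i ∈ S
    · split_ifs with hb
      · subst hb
        have hr := hbound i S hi a x hx
        rw [hφ.resistance_eq, Finset.sum_const, nsmul_eq_mul] at hr
        refine (mul_le_mul (realizationProb_le h0 h1 hq hi a) (acceptProb_le _ hτ _ _)
          (acceptProb_nonneg _ _ _ _) (by positivity)).trans ?_
        rw [← Real.exp_nat_mul, ← Real.exp_add, Real.exp_le_exp]
        have := mul_le_mul_of_nonneg_left hr (one_div_pos.2 hτ).le
        linarith
      · rw [mul_zero]
        positivity
    · rw [realizationProb_eq_zero hi, zero_mul]
      positivity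
  have hx : ∀ i, ∑ x ∈ C i (a i), 1 / (((C i (a i)).card : ℕ) : ℝ) *
      ∑ S : Finset ι, realizationProb (uniformLink A pc) i S a *
      ((if b = Function.update a i x then acceptProb (W i S) τ a (Function.update a i x) else 0) +
        (if b = a then keepProb (W i S) τ a (Function.update a i x) else 0)) ≤ K := by
    intro i
    have hc : (((C i (a i)).card : ℕ) : ℝ) ≠ 0 := Nat.cast_ne_zero.2 (hC i (a i)).card_pos.ne'
    calc _ ≤ ∑ x ∈ C i (a i), 1 / (((C i (a i)).card : ℕ) : ℝ) * K := by
          refine Finset.sum_le_sum fun x hx => mul_le_mul_of_nonneg_left ?_ (by positivity)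
          refine (Finset.sum_le_card_nsmul _ _ _ fun S _ => hS i x hx S).trans_eq ?_
          rw [Finset.card_univ, Fintype.card_finset, nsmul_eq_mul, hK]
          push_cast
          rfl
      _ = K := by
          rw [Finset.sum_const, nsmul_eq_mul, ← mul_assoc, mul_one_div_cancel hc, one_mul]
  calc _ ≤ ∑ _i : ι, 1 / (Fintype.card ι : ℝ) * K :=
        Finset.sum_le_sum fun i _ => mul_le_mul_of_nonneg_left (hx i) (by positivity)
    _ = K := by
        rw [Finset.sum_const, nsmul_eq_mul, ← mul_assoc, Finset.card_univ,
          mul_one_div_cancel (Nat.cast_ne_zero.2 Fintype.card_ne_zero), one_mul]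

/-- Lower bound on the probabilities of the feasible transitions by the resistance of the potential,
obtained from the event that all links are present. -/
lemma le_transition [Nonempty ι] (hφ : IsPotential U φ) (hC : ∀ i x, (C i x).Nonempty)
    (hW : ExtendsUtility W U) (hpc : 1 / 2 ≤ pc) (h1 : pc ≤ 1) (hτ : 0 < τ)
    {M : ℝ} (hM : ∀ i x, ((C i x).card : ℝ) ≤ M) (a : ∀ i, A i) {i : ι} {x : A i}
    (hx : x ∈ C i (a i)) :
    1 / (Fintype.card ι : ℝ) * (1 / M * ((1 / 2) ^ Fintype.card ι *
        (1 / 2 * Real.exp (-(1 / τ * resistance φ a (Function.update a i x)))))) ≤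
      transition W C (uniformLink A pc) τ a (Function.update a i x) := by
  have h0 : 0 ≤ pc := by linarith
  have hterm : ∀ (i' : ι) (x' : A i') (S : Finset ι),
      0 ≤ realizationProb (uniformLink A pc) i' S a *
      ((if Function.update a i x = Function.update a i' x' then
          acceptProb (W i' S) τ a (Function.update a i' x') else 0) +
        (if Function.update a i x = a then
          keepProb (W i' S) τ a (Function.update a i' x') else 0)) := by
    intro i' x' S
    refine mul_nonneg (realizationProb_nonneg h0 h1 i' S a) (add_nonneg ?_ ?_)
    · split_ifs
      exacts [acceptProb_nonneg _ _ _ _, le_rfl]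
    · split_ifs
      exacts [keepProb_nonneg _ _ _ _, le_rfl]
  have hM0 : (0 : ℝ) < (C i (a i)).card := Nat.cast_pos.2 (hC i (a i)).card_pos
  have hWU : W i Finset.univ = U i := funext (hW i)
  refine le_trans ?_ (Finset.single_le_sum (fun i' _ => mul_nonneg (by positivity) <|
    Finset.sum_nonneg fun x' _ => mul_nonneg (by positivity) <| Finset.sum_nonneg fun S _ =>
      hterm i' x' S) (Finset.mem_univ i))
  refine mul_le_mul_of_nonneg_left ?_ (by positivity)
  refine le_trans ?_ (Finset.single_le_sum (fun x' _ => mul_nonneg (by positivity) <|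
    Finset.sum_nonneg fun S _ => hterm i x' S) hx)
  refine mul_le_mul (one_div_le_one_div_of_le hM0 (hM i (a i))) ?_ (by positivity) (by positivity)
  refine le_trans ?_ (Finset.single_le_sum (fun S _ => hterm i x S) (Finset.mem_univ Finset.univ))
  refine mul_le_mul (le_realizationProb_univ hpc i a) ?_ (by positivity)
    (realizationProb_nonneg h0 h1 i _ a)
  rw [if_pos rfl, hWU, ← hφ.resistance_eq]
  refine (le_acceptProb _ hτ _ _).trans (le_add_of_nonneg_right ?_)
  split_ifs
  exacts [keepProb_nonneg _ _ _ _, le_rfl]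

lemma transition_pos [Nonempty ι] (hφ : IsPotential U φ) (hC : ∀ i x, (C i x).Nonempty)
    (hW : ExtendsUtility W U) (hpc : 1 / 2 ≤ pc) (h1 : pc ≤ 1) (hτ : 0 < τ)
    {M : ℝ} (hM : ∀ i x, ((C i x).card : ℝ) ≤ M) (a : ∀ i, A i) {i : ι} {x : A i}
    (hx : x ∈ C i (a i)) :
    0 < transition W C (uniformLink A pc) τ a (Function.update a i x) := by
  refine lt_of_lt_of_le ?_ (le_transition hφ hC hW hpc h1 hτ hM a hx)
  have hM0 : 0 < M := (Nat.cast_pos.2 (hC i (a i)).card_pos).trans_le (hM i (a i))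
  have : (0 : ℝ) < Fintype.card ι := Nat.cast_pos.2 Fintype.card_pos
  positivity

/-- The chain is irreducible: the actions can be changed one agent at a time. -/
lemma transition_irreducible [Nonempty ι] (hφ : IsPotential U φ) (hC : ∀ i x, (C i x).Nonempty)
    (hreach : Reachable C) (hW : ExtendsUtility W U) (hpc : 1 / 2 ≤ pc) (h1 : pc ≤ 1) (hτ : 0 < τ)
    {M : ℝ} (hM : ∀ i x, ((C i x).card : ℝ) ≤ M) (a b : ∀ i, A i) :
    Relation.ReflTransGen
      (fun x y => 0 < transition W C (uniformLink A pc) τ x y) a b := by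
  have hstep : ∀ (a : ∀ i, A i) (i : ι) (x : A i), Relation.ReflTransGen
      (fun x y => 0 < transition W C (uniformLink A pc) τ x y) a (Function.update a i x) := by
    intro a i x
    have h := (hreach i (a i) x).lift (Function.update a i)
      (p := fun x y => 0 < transition W C (uniformLink A pc) τ x y) (fun y z hyz => by
        have := transition_pos hφ hC hW hpc h1 hτ hM (Function.update a i y) (i := i) (x := z)
          (by rwa [Function.update_self])
        rwa [Function.update_idem] at this)
    rwa [Function.onFun, Function.update_eq_self] at h
  have hs : ∀ s : Finset ι, Relation.ReflTransGen
      (fun x y => 0 < transition W C (uniformLink A pc) τ x y) a (s.piecewise b a) := by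
    intro s
    induction s using Finset.induction_on with
    | empty => rw [Finset.piecewise_empty]
    | insert i s _ ih =>
      rw [Finset.piecewise_insert]
      exact ih.trans (hstep _ _ _)
  simpa using hs Finset.univ

/-- Detailed balance with respect to the Gibbs weights, up to a factor that depends neither on the
temperature nor on the connectivity. -/
lemma gibbs_almost_reversible [Nonempty ι] (hφ : IsPotential U φ) (hC : ∀ i x, (C i x).Nonempty)
    (hrev : Reversible C) (hW : ExtendsUtility W U)
    (hbound : LinkBound U W C (fun _ _ _ => m)) (hpc : 1 / 2 ≤ pc) (h1 : pc ≤ 1) (hτ : 0 < τ)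
    (hq : 1 - pc ≤ Real.exp (-(1 / τ * m))) {M : ℝ} (hM1 : 1 ≤ M)
    (hM : ∀ i x, ((C i x).card : ℝ) ≤ M) (a b : ∀ i, A i) :
    Real.exp (1 / τ * φ b) * transition W C (uniformLink A pc) τ b a ≤
      (2 * 4 ^ Fintype.card ι * Fintype.card ι * M) *
        (Real.exp (1 / τ * φ a) * transition W C (uniformLink A pc) τ a b) := by
  have h0 : 0 ≤ pc := by linarith
  have hn : (1 : ℝ) ≤ Fintype.card ι := Nat.one_le_cast.2 Fintype.card_pos
  have hM0 : 0 < M := by linarith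
  set D : ℝ := 2 * 4 ^ Fintype.card ι * Fintype.card ι * M with hD
  have hD1 : 1 ≤ D := by
    have h4 : (1 : ℝ) ≤ 4 ^ Fintype.card ι := one_le_pow₀ (by norm_num)
    exact one_le_mul_of_one_le_of_one_le (one_le_mul_of_one_le_of_one_le
      (one_le_mul_of_one_le_of_one_le one_le_two h4) hn) hM1
  have hP := transition_nonneg (W := W) (C := C) (τ := τ) h0 h1 a b
  by_cases hab : a = b
  · subst hab
    exact le_mul_of_one_le_left (mul_nonneg (Real.exp_pos _).le hP) hD1
  by_cases hf : ∃ i, ∃ x ∈ C i (b i), a = Function.update b i x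
  · obtain ⟨i, x, hx, rfl⟩ := hf
    set a := Function.update b i x with ha
    have hback : Function.update a i (b i) = b := by
      rw [ha, Function.update_idem, Function.update_eq_self]
    have hlow := le_transition hφ hC hW hpc h1 hτ hM a (i := i) (x := b i)
      (by rw [ha, Function.update_self]; exact hrev i _ _ hx)
    rw [hback] at hlow
    have hup := transition_le hφ hC hbound h0 h1 hτ hq hab
    -- Both flows carry the symmetric weight `exp (β * (φ a + φ b - max (φ a) (φ b)))`.
    have hsym : Real.exp (1 / τ * φ b) * Real.exp (-(1 / τ * resistance φ b a)) =
        Real.exp (1 / τ * φ a) * Real.exp (-(1 / τ * resistance φ a b)) := by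
      rw [← Real.exp_add, ← Real.exp_add, resistance, resistance, max_comm]
      congr 1
      ring
    calc _ ≤ Real.exp (1 / τ * φ b) *
          (2 ^ Fintype.card ι * Real.exp (-(1 / τ * resistance φ b a))) :=
          mul_le_mul_of_nonneg_left hup (Real.exp_pos _).le
      _ = 2 ^ Fintype.card ι *
          (Real.exp (1 / τ * φ a) * Real.exp (-(1 / τ * resistance φ a b))) := by
          rw [← hsym]; ring
      _ = D * (Real.exp (1 / τ * φ a) * (1 / (Fintype.card ι : ℝ) * (1 / M *
          ((1 / 2) ^ Fintype.card ι * (1 / 2 * Real.exp (-(1 / τ * resistance φ a b))))))) := by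
          have h4 : (4 : ℝ) ^ Fintype.card ι = 2 ^ Fintype.card ι * 2 ^ Fintype.card ι := by
            rw [← mul_pow]; norm_num
          rw [hD, h4, div_pow, one_pow]
          field_simp
      _ ≤ _ := mul_le_mul_of_nonneg_left
          (mul_le_mul_of_nonneg_left hlow (Real.exp_pos _).le) (by linarith)
  · push Not at hf
    rw [transition_eq_zero _ hab hf, mul_zero]
    exact mul_nonneg (by linarith) (mul_nonneg (Real.exp_pos _).le hP)

end Transition

/-! ### Concentration on the maximizers of the potential -/

/-- The relative Gibbs weight of the states outside the set of maximizers of `φ`, where `aMax` is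
one of the maximizers, vanishes in the limit of zero temperature. -/
lemma tendsto_gibbs_nonmaximizers {ι : Type*} [Fintype ι] [DecidableEq ι] {A : ι → Type*}
    [∀ i, Fintype (A i)] (φ : (∀ i, A i) → ℝ) {aMax : ∀ i, A i} (hmax : ∀ b, φ b ≤ φ aMax)
    (s : Finset (∀ i, A i)) (hs : ∀ a ∈ s, a ∉ maximizers φ) (K : ℝ) :
    Filter.Tendsto (fun β : ℝ => ∑ a ∈ s, K * Real.exp (-(β * (φ aMax - φ a))))
      Filter.atTop (nhds 0) := by
  rw [← Finset.sum_const_zero (ι := ∀ i, A i) (s := s)]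
  refine tendsto_finsetSum _ fun a ha => ?_
  have hlt : 0 < φ aMax - φ a := by
    rw [sub_pos]
    refine lt_of_le_of_ne (hmax a) fun h => hs a ha ?_
    simpa [maximizers, h] using hmax
  have h := (Real.tendsto_exp_neg_atTop_nhds_zero.comp
    (Filter.tendsto_id.atTop_mul_const hlt)).const_mul K
  rwa [mul_zero] at h

/-- With `τ = -m / log ((1 - pc) / pc)` and `E = exp (m β₀)`, a connectivity of at least
`E / (1 + E)` gives an inverse temperature of at least `β₀`. -/
lemma inverse_temperature {m pc τ β₀ : ℝ} (hm : 0 < m) (hβ₀ : 0 < β₀)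
    (hpc : Real.exp (m * β₀) / (1 + Real.exp (m * β₀)) ≤ pc) (hpc1 : pc < 1)
    (hτ : τ = -m / Real.log ((1 - pc) / pc)) :
    0 < τ ∧ β₀ ≤ 1 / τ ∧ Real.exp (-(1 / τ * m)) = (1 - pc) / pc := by
  have hE := Real.exp_pos (m * β₀)
  have hpc0 : 0 < pc := (by positivity : 0 < Real.exp (m * β₀) / (1 + Real.exp (m * β₀))).trans_le
    hpc
  have hr0 : 0 < (1 - pc) / pc := div_pos (by linarith) hpc0
  rw [div_le_iff₀ (by positivity)] at hpc
  have hr : (1 - pc) / pc ≤ Real.exp (-(m * β₀)) := by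
    rw [Real.exp_neg, div_le_iff₀ hpc0, inv_mul_eq_div, le_div_iff₀ hE]
    linarith
  have hlog : Real.log ((1 - pc) / pc) ≤ -(m * β₀) := by
    rw [← Real.log_exp (-(m * β₀))]
    exact Real.log_le_log hr0 hr
  have hmβ : 0 < m * β₀ := mul_pos hm hβ₀
  have hneg : Real.log ((1 - pc) / pc) < 0 := by linarith
  have hinv : 1 / τ = -Real.log ((1 - pc) / pc) / m := by
    rw [hτ, one_div_div, div_neg, neg_div]
  refine ⟨?_, ?_, ?_⟩
  · rw [hτ]
    exact div_pos_of_neg_of_neg (by linarith) hneg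
  · rw [hinv, le_div_iff₀ hm]
    linarith
  · rw [hinv, div_mul_cancel₀ _ hm.ne', neg_neg, Real.exp_log hr0]

end BLLL

open BLLL in
theorem theorem3 {ι : Type*} [Fintype ι] [DecidableEq ι] [Nonempty ι]
    {A : ι → Type*} [∀ i, Fintype (A i)] [∀ i, DecidableEq (A i)] [∀ i, Nonempty (A i)]
    (U : ι → (∀ i, A i) → ℝ) (φ : (∀ i, A i) → ℝ) (hφ : BLLL.IsPotential U φ)
    (C : ∀ i, A i → Finset (A i)) (hC : ∀ i x, (C i x).Nonempty)
    (hreach : BLLL.Reachable C) (hrev : BLLL.Reversible C)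
    (W : ι → Finset ι → (∀ i, A i) → ℝ) (hW : BLLL.ExtendsUtility W U)
    (m : ℝ) (hm : 0 < m) (hbound : BLLL.LinkBound U W C (fun _ _ _ => m))
    (ptar : ℝ) (hptar : ptar < 1) :
    ∃ pth : ℝ, 1 / 2 < pth ∧ pth < 1 ∧
      ∀ pc τ : ℝ, pth ≤ pc → pc < 1 → τ = -m / Real.log ((1 - pc) / pc) →
        (∃! μ : (∀ i, A i) → ℝ,
          BLLL.IsStationary (BLLL.transition W C (BLLL.uniformLink A pc) τ) μ) ∧
        ∀ μ : (∀ i, A i) → ℝ,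
          BLLL.IsStationary (BLLL.transition W C (BLLL.uniformLink A pc) τ) μ →
            ptar ≤ ∑ a ∈ BLLL.maximizers φ, μ a := by
 
  classical
  obtain ⟨aMax, hmax⟩ := Finite.exists_max φ
  obtain ⟨M, hM1, hM⟩ : ∃ M : ℝ, 1 ≤ M ∧ ∀ i x, ((C i x).card : ℝ) ≤ M := by
    refine ⟨1 + ∑ i, (Fintype.card (A i) : ℝ), ?_, fun i x => ?_⟩
    · linarith [Finset.sum_nonneg fun i (_ : i ∈ Finset.univ) =>
        (Nat.cast_nonneg (Fintype.card (A i)) : (0 : ℝ) ≤ _)]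
    · have h1 : ((C i x).card : ℝ) ≤ Fintype.card (A i) := Nat.cast_le.2 (Finset.card_le_univ _)
      have h2 := Finset.single_le_sum (f := fun i => (Fintype.card (A i) : ℝ))
        (fun i _ => Nat.cast_nonneg _) (Finset.mem_univ i)
      linarith
  set D : ℝ := 2 * 4 ^ Fintype.card ι * Fintype.card ι * M with hD
  have hD1 : 1 ≤ D := by
    have h4 : (1 : ℝ) ≤ 4 ^ Fintype.card ι := one_le_pow₀ (by norm_num)
    have hn : (1 : ℝ) ≤ Fintype.card ι := Nat.one_le_cast.2 Fintype.card_pos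
    exact one_le_mul_of_one_le_of_one_le (one_le_mul_of_one_le_of_one_le
      (one_le_mul_of_one_le_of_one_le one_le_two h4) hn) hM1
  set K : ℝ := D ^ Fintype.card (∀ i, A i) with hK
  obtain ⟨β₁, hβ₁⟩ := Filter.eventually_atTop.1 ((tendsto_gibbs_nonmaximizers φ hmax
    (maximizers φ)ᶜ (fun a ha => Finset.mem_compl.1 ha) K).eventually
      (ge_mem_nhds (sub_pos.2 hptar)))
  have hE1 : 1 < Real.exp (m * max β₁ 1) :=
    Real.one_lt_exp_iff.2 (mul_pos hm (lt_max_of_lt_right one_pos))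
  refine ⟨Real.exp (m * max β₁ 1) / (1 + Real.exp (m * max β₁ 1)), ?_, ?_, ?_⟩
  · rw [lt_div_iff₀ (by positivity)]
    linarith
  · rw [div_lt_one (by positivity)]
    linarith
  intro pc τ hpth hpc1 hτeq
  have hpc : 1 / 2 ≤ pc := by
    refine le_trans ?_ hpth
    rw [le_div_iff₀ (by positivity)]
    linarith
  obtain ⟨hτ, hβ, hexp⟩ := inverse_temperature hm (lt_max_of_lt_right one_pos) hpth hpc1 hτeq
  have hq : 1 - pc ≤ Real.exp (-(1 / τ * m)) := by
    rw [hexp, le_div_iff₀ (by linarith)]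
    exact mul_le_of_le_one_right (by linarith) hpc1.le
  have hP0 := transition_nonneg (W := W) (C := C) (τ := τ) (by linarith : 0 ≤ pc) hpc1.le
  have hP1 := sum_transition (W := W) (τ := τ) hC (uniformLink A pc)
  have hirr := transition_irreducible hφ hC hreach hW hpc hpc1.le hτ hM
  refine ⟨?_, fun μ hμ => ?_⟩
  · obtain ⟨μ, hμ⟩ := exists_isStationary hP0 hP1
    exact ⟨μ, hμ, fun ν hν => isStationary_unique hP0 hP1 hirr hν hμ⟩
  have hle : ∀ a, μ a ≤ K * Real.exp (-(1 / τ * (φ aMax - φ a))) := by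
    intro a
    have h := almost_proportional hP0 hP1 hirr (w := fun a => Real.exp (1 / τ * φ a))
      (fun a => Real.exp_pos _) hD1
      (gibbs_almost_reversible hφ hC hrev hW hbound hpc hpc1.le hτ hq hM1 hM) hμ.1.1 hμ.2 a aMax
    have hμ1 : μ aMax ≤ 1 := by
      rw [← hμ.1.2]
      exact Finset.single_le_sum (fun b _ => hμ.1.1 b) (Finset.mem_univ aMax)
    rw [div_le_iff₀ (Real.exp_pos _), mul_assoc, div_mul_eq_mul_div, mul_div_assoc,
      ← Real.exp_sub] at h
    refine h.trans (mul_le_mul_of_nonneg_left ?_ (by positivity))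
    refine (mul_le_of_le_one_left (Real.exp_pos _).le hμ1).trans_eq ?_
    congr 1
    ring
  have hsum := Finset.sum_add_sum_compl (maximizers φ) μ
  rw [hμ.1.2] at hsum
  have := (Finset.sum_le_sum fun a (_ : a ∈ (maximizers φ)ᶜ) => hle a).trans
    (hβ₁ (1 / τ) ((le_max_left _ _).trans hβ))
  linarith
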